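/- Let $X$ be an irreducible complex affine variety of dimension $n$ with an algebraic action of a torus $T=(\mathbb{C}^*)^r$, and let $x_0\in X$ be an attractive fixed point: $x_0$ is fixed by $T$, and there are a one-parameter subgroup $\lambda:\mathbb{C}^*\to T$ and a Zariski neighbourhood $U$ of $x_0$ such that $\lim_{t\to 0}\lambda(t)\cdot y=x_0$ for all $y\in U$. Fix such a $\lambda$. Let $\mathbb{R}^+$ be the multiplicative group of positive real numbers, acting on $X$ through $\lambda$, and let $\mathbb{S}(X):=(X\setminus\{x_0\})/\mathbb{R}^+$ with the quotient topology. Topological notions refer to the complex topology, and $H^*$ is singular cohomology with rational coefficients. One says that $X$ is rationally smooth at $x$ if $x$ has a neighbourhood $U$ (in the complex topology) such that for all $y\in U$ one has $H^m(X,X\setminus\{y\})=0$ for $m\neq 2n$ and $H^{2n}(X,X\setminus\{y\})\cong\mathbb{Q}$. A rational cohomology $(2n-1)$-sphere is a space whose rational Betti numbers are those of $\mathbb{S}^{2n-1}$ (for $n=0$: the empty space). If $X$ is rationally smooth at $x_0$, then $(X,x_0)$ is called a rational cell. Then the following hold. 1. $X\setminus\{x_0\}$ is homeomorphic to $\mathbb{S}(X)\times\mathbb{R}^+$,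 and $\mathbb{S}(X)$ is compact. 2. $X\setminus\{x_0\}$ deformation retracts onto $\mathbb{S}(X)$: the quotient map $q:X\setminus\{x_0\}\to\mathbb{S}(X)$ has a continuous section $s$, and the identity of $X\setminus\{x_0\}$ is homotopic to $s\circ q$ relative to the image of $s$. 3. If $(X,x_0)$ is a rational cell, then $X\setminus\{x_0\}$ and $\mathbb{S}(X)$ are rational cohomology $(2n-1)$-spheres. 4. Suppose that $X$ is rationally smooth at every point of $X\setminus\{x_0\}$. Then $X$ is rationally smooth at $x_0$ if and only if $X\setminus\{x_0\}$ is a rational cohomology $(2n-1)$-sphere, and also if and only if $\mathbb{S}(X)$ is one. In particular, 1, 2 and the equivalences in 4 hold for every rational cell. -/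

import Mathlib

open CategoryTheory Topology Filter

universe u

noncomputable section

/-! ### Singular cohomology with rational coefficients -/

namespace RatCoh

/-- The rational singular chain complex of a topological space. -/
def chains (Y : TopCat.{u}) : ChainComplex (ModuleCat.{u} ℚ) ℕ :=
  ((AlgebraicTopology.singularChainComplexFunctor (ModuleCat.{u} ℚ)).obj
    (ModuleCat.of ℚ (ULift.{u} ℚ))).obj Y

/-- The chain map induced by a continuous map. -/
def chainsMap {Y Z : TopCat.{u}} (f : Y ⟶ Z) : chains Y ⟶ chains Z :=
  ((AlgebraicTopology.singularChainComplexFunctor (ModuleCat.{u} ℚ)).obj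
    (ModuleCat.of ℚ (ULift.{u} ℚ))).map f

/-- The cohomology in degree `m` of the dual complex `Hom(K, ℚ)` of a complex `K` of rational
vector spaces. -/
def dualCohomology (K : ChainComplex (ModuleCat.{u} ℚ) ℕ) (m : ℕ) : ModuleCat.{u} ℚ :=
  (K.linearYonedaObj ℚ (ModuleCat.of ℚ (ULift.{u} ℚ))).homology m

/-- The singular cohomology `H^m(Y; ℚ)`. -/
def H (Y : Type u) [TopologicalSpace Y] (m : ℕ) : ModuleCat.{u} ℚ :=
  dualCohomology (chains (TopCat.of Y)) m

/-- The inclusion of a subspace. -/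
def incl {Y : Type u} [TopologicalSpace Y] (B : Set Y) : TopCat.of B ⟶ TopCat.of Y :=
  TopCat.ofHom ⟨Subtype.val, continuous_subtype_val⟩

/-- The relative singular cohomology `H^m(Y, B; ℚ)`: the cohomology of the dual of the complex
`C(Y) / C(B)` of relative singular chains. -/
def relH (Y : Type u) [TopologicalSpace Y] (B : Set Y) (m : ℕ) : ModuleCat.{u} ℚ :=
  dualCohomology (Limits.cokernel (chainsMap (incl B))) m

end RatCoh

/-- A space `Y` of complex dimension `n` is rationally smooth at `x` if there is a neighbourhood `U`
of `x` such that, for all `y ∈ U`, the space `H^m(Y, Y - {y}; ℚ)` is zero for `m ≠ 2n` and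
one-dimensional for `m = 2n`. -/
def RationallySmoothAt (n : ℕ) (Y : Type u) [TopologicalSpace Y] (x : Y) : Prop :=
  ∃ U ∈ 𝓝 x, ∀ y ∈ U, ∀ m : ℕ,
    Module.rank ℚ (RatCoh.relH Y {y}ᶜ m) = if m = 2 * n then 1 else 0

/-- `Y` is a rational cohomology sphere of dimension `d ≥ -1`: its rational Betti numbers are those
of the sphere `S^d`, namely `1` in degrees `0` and `d` and `0` in the other degrees if `d ≥ 1`. The
formula also covers `d = 0` (two points) and `d = -1` (the empty sphere). -/
def IsRationalCohomologySphere (d : ℤ) (Y : Type u) [TopologicalSpace Y] : Prop :=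
  ∀ m : ℕ, Module.rank ℚ (RatCoh.H Y m) =
    (if m = 0 ∧ 0 ≤ d then 1 else 0) + (if (m : ℤ) = d then 1 else 0)

/-! ### Affine varieties and torus actions -/

/-- The set of (closed, i.e. complex) points of the affine variety with coordinate ring `A`. -/
def ComplexPoints (A : Type u) [CommRing A] [Algebra ℂ A] : Type u := A →ₐ[ℂ] ℂ

namespace ComplexPoints

variable {A : Type u} [CommRing A] [Algebra ℂ A]

/-- The evaluation of regular functions at a point. -/
def eval (x : ComplexPoints A) : A →ₐ[ℂ] ℂ := x

/-- The complex topology: the coarsest one in which every regular function is continuous. For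
generators `a₁, …, a_N` of `A` it is the topology of the closed subset of `ℂ^N` formed by the points
`(a₁(x), …, a_N(x))`. -/
instance : TopologicalSpace (ComplexPoints A) :=
  TopologicalSpace.induced (fun x (f : A) => x.eval f) inferInstance

end ComplexPoints

/-- The complex points of the torus `(ℂ^*)^r`. -/
abbrev Torus (r : ℕ) : Type := Fin r → ℂˣ

/-- The action of the torus is algebraic, i.e. `(t, x) ↦ t • x` is a morphism of varieties
`T × X → X`: for every regular function `f`, the function `(t, x) ↦ f (t • x)` is a polynomial in
`t₁, …, t_r, t₁⁻¹, …, t_r⁻¹` with coefficients in the coordinate ring of `X`. -/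
def IsAlgebraicAction (r : ℕ) (A : Type u) [CommRing A] [Algebra ℂ A]
    [MulAction (Torus r) (ComplexPoints A)] : Prop :=
  ∀ f : A, ∃ F : MvPolynomial (Fin r ⊕ Fin r) A, ∀ (t : Torus r) (x : ComplexPoints A),
    (t • x).eval f = F.eval₂ (x.eval : A →+* ℂ)
      (Sum.elim (fun i => (t i : ℂ)) (fun i => ((t i)⁻¹ : ℂˣ)))

/-- A one-parameter subgroup `ℂ^* → T` is a homomorphism of algebraic groups: a group homomorphism
whose components are Laurent polynomials. -/
def IsOneParameterSubgroup {r : ℕ} (lam : ℂˣ →* Torus r) : Prop :=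
  ∀ i, ∃ p : LaurentPolynomial ℂ, ∀ t : ℂˣ,
    (lam t i : ℂ) = LaurentPolynomial.eval₂ (RingHom.id ℂ) t p

section Cell

variable {A : Type u} [CommRing A] [Algebra ℂ A] {r : ℕ} [MulAction (Torus r) (ComplexPoints A)]

/-- There is a Zariski neighbourhood `U` of `x₀` (it may be taken of the form `{f ≠ 0}`) such that
`lam t • y` tends to `x₀` as `t → 0`, for all `y` in `U`. -/
def IsAttractedBy (lam : ℂˣ →* Torus r) (x₀ : ComplexPoints A) : Prop :=
  ∃ f : A, x₀.eval f ≠ 0 ∧ ∀ y : ComplexPoints A, y.eval f ≠ 0 →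
    Tendsto (fun t : ℂˣ => lam t • y) (comap (fun t : ℂˣ => (t : ℂ)) (𝓝 0)) (𝓝 x₀)

/-- The complement `X - {x₀}`. -/
abbrev Punctured (x₀ : ComplexPoints A) : Type u := ↥({x₀}ᶜ : Set (ComplexPoints A))

/-- A positive real number as an element of `ℂ^*`. -/
def posUnit (s : Set.Ioi (0 : ℝ)) : ℂˣ :=
  Units.mk0 ((s : ℝ) : ℂ) (Complex.ofReal_ne_zero.mpr (ne_of_gt s.2))

/-- The orbit relation on `X - {x₀}` of the group of positive real numbers, acting through `lam`. -/
def linkSetoid (lam : ℂˣ →* Torus r) (x₀ : ComplexPoints A) : Setoid (Punctured x₀) where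
  r y z := ∃ s : Set.Ioi (0 : ℝ), lam (posUnit s) • (y : ComplexPoints A) = z
  iseqv := by
    refine ⟨fun y => ⟨⟨1, Set.mem_Ioi.mpr one_pos⟩, ?_⟩, ?_, ?_⟩
    · have h : posUnit ⟨1, Set.mem_Ioi.mpr one_pos⟩ = 1 := by ext; simp [posUnit]
      rw [h, map_one, one_smul]
    · rintro y z ⟨s, hs⟩
      refine ⟨⟨(s : ℝ)⁻¹, Set.mem_Ioi.mpr (inv_pos.mpr s.2)⟩, ?_⟩
      have h : posUnit ⟨(s : ℝ)⁻¹, Set.mem_Ioi.mpr (inv_pos.mpr s.2)⟩ = (posUnit s)⁻¹ := by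
        ext; simp [posUnit]
      rw [h, map_inv, ← hs, inv_smul_smul]
    · rintro y z w ⟨s, hs⟩ ⟨t, ht⟩
      refine ⟨⟨(t : ℝ) * s, Set.mem_Ioi.mpr (mul_pos t.2 s.2)⟩, ?_⟩
      have h : posUnit ⟨(t : ℝ) * s, Set.mem_Ioi.mpr (mul_pos t.2 s.2)⟩ = posUnit t * posUnit s := by
        ext; simp [posUnit]
      rw [h, map_mul, mul_smul, hs, ht]

/-- The space `S(X) = (X - {x₀}) / ℝ^+`, with the quotient topology. -/
abbrev Link (lam : ℂˣ →* Torus r) (x₀ : ComplexPoints A) : Type u := Quotient (linkSetoid lam x₀)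

/-- The quotient map `X - {x₀} → S(X)`. -/
def linkProj (lam : ℂˣ →* Torus r) (x₀ : ComplexPoints A) : C(Punctured x₀, Link lam x₀) :=
  ⟨Quotient.mk _, continuous_quotient_mk'⟩

end Cell

end

/-! Attraction forces positive weights. If `g` has weight `k ≤ 0`, then `t^(-k) g(λ(t)y) = g(y)`
does not depend on `t`; letting `t → 0` shows that `g` is constant on a nonempty Zariski open set,
hence on `X`, which is irreducible. So the coordinate ring is generated by homogeneous `a_i` of
weights `d_i > 0` (`exists_homogeneous_generators`). They embed `X` as a closed subset of an affine
space on which `λ(t)` multiplies the `i`-th coordinate by `t^(d_i)`, with `x₀` at the origin.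

The action of the positive reals therefore extends continuously to `s = 0`, and `φ = ∑
|a_i|^(1/d_i)` is homogeneous of degree one, vanishes only at `x₀` and has a compact level set `φ =
1` (`exists_isRadial`). Each orbit in `X - {x₀}` meets this level set exactly once, which gives the
section, the polar coordinates, the compactness of the link and the retraction. Scaling down to `0`
contracts `X`.

Since `X` is contractible, the long exact sequence identifies the homology of `(X, X - {x₀})` with
the reduced homology of `X - {x₀}`, shifted by one; duality over `ℚ` carries this to cohomology
(`rank_relH_iff_isRationalCohomologySphere`). This settles the condition at `x₀` itself; at the
other points it is the hypothesis of the criterion. -/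

noncomputable section

/-! ### Homology of pairs and the dual complex -/

namespace RatCoh

open Limits

/-- Over a field every vector space is injective. -/
instance injective_rat : Injective (ModuleCat.of.{u} ℚ (ULift.{u} ℚ)) :=
  have := Module.injective_of_isSemisimpleRing ℚ (ULift.{u} ℚ)
  Module.injective_object_of_injective_module ℚ (ULift.{u} ℚ)

/-- The functor `V ↦ Hom(V, ℚ)`, with values in the opposite category. -/
abbrev dualFunctor : ModuleCat.{u} ℚ ⥤ (ModuleCat.{u} ℚ)ᵒᵖ :=
  ((linearYoneda ℚ (ModuleCat.{u} ℚ)).obj (ModuleCat.of ℚ (ULift.{u} ℚ))).rightOp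

/-- `ℚ` is injective, so a form that vanishes on the image of an exact sequence extends along the
next map: `Hom(-, ℚ)` is exact. -/
instance dualFunctor_preservesHomology : (dualFunctor.{u}).PreservesHomology := by
  apply Functor.preservesHomology_of_map_exact
  intro S hS
  rw [← ShortComplex.exact_unop_iff, ShortComplex.moduleCat_exact_iff]
  intro φ hφ
  have h : S.f ≫ (φ : S.X₂ ⟶ ModuleCat.of ℚ (ULift.{u} ℚ)) = 0 := hφ
  exact ⟨hS.descToInjective φ h, hS.comp_descToInjective φ h⟩

/-- Universal coefficients over a field: the cohomology of the dual complex is the dual of the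
homology. -/
def dualCohomologyIso (K : ChainComplex (ModuleCat.{u} ℚ) ℕ) (m : ℕ) :
    dualCohomology K m ≅ (dualFunctor.obj (K.homology m)).unop :=
  HomologicalComplex.homologyUnop ((dualFunctor.mapHomologicalComplex _).obj K) m ≪≫
    (ShortComplex.mapHomologyIso (K.sc m) dualFunctor).symm.unop

/-- The dual of `V` in the category of vector spaces is the module of linear forms. -/
def dualFunctorEquiv (V : ModuleCat.{u} ℚ) :
    (dualFunctor.obj V).unop ≃ₗ[ℚ] (V →ₗ[ℚ] ULift.{u} ℚ) :=
  ModuleCat.homLinearEquiv (S := ℚ)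

lemma rank_dual_eq_zero_iff (V : ModuleCat.{u} ℚ) :
    Module.rank ℚ (dualFunctor.obj V).unop = 0 ↔ Module.rank ℚ V = 0 := by
  rw [((dualFunctorEquiv V).trans (LinearEquiv.congrRight ULift.moduleEquiv)).rank_eq,
    rank_zero_iff, rank_zero_iff]
  exact Module.subsingleton_dual_iff ℚ

lemma rank_dual_eq_one_iff (V : ModuleCat.{u} ℚ) :
    Module.rank ℚ (dualFunctor.obj V).unop = 1 ↔ Module.rank ℚ V = 1 := by
  rw [((dualFunctorEquiv V).trans (LinearEquiv.congrRight ULift.moduleEquiv)).rank_eq]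
  have key (W : Type u) [AddCommGroup W] [Module ℚ W] :
      Module.rank ℚ W = 1 ↔ Module.Finite ℚ W ∧ Module.finrank ℚ W = 1 := by
    refine ⟨fun h => ⟨Module.finite_of_rank_eq_one h,
        Module.finrank_eq_of_rank_eq (by simpa using h)⟩,
      fun ⟨_, h⟩ => by rw [← Module.finrank_eq_rank, h, Nat.cast_one]⟩
  rw [key, key]
  exact and_congr (Module.finite_dual_iff ℚ) (by rw [Subspace.dual_finrank_eq])

/-- The restriction to `0` and `1` matters: an infinite-dimensional space and its dual have
different ranks. The Betti numbers in question are all `0` or `1`. -/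
lemma rank_dualCohomology_eq_iff (K : ChainComplex (ModuleCat.{u} ℚ) ℕ) (m : ℕ) (c : Cardinal.{u})
    (hc : c = 0 ∨ c = 1) :
    Module.rank ℚ (dualCohomology K m) = c ↔ Module.rank ℚ (K.homology m) = c := by
  rw [(dualCohomologyIso K m).toLinearEquiv.rank_eq]
  rcases hc with rfl | rfl
  · exact rank_dual_eq_zero_iff _
  · exact rank_dual_eq_one_iff _

/-- The short exact sequence of singular chains of a pair. -/
abbrev pairSequence {Y : Type u} [TopologicalSpace Y] (B : Set Y) :
    ShortComplex (ChainComplex (ModuleCat.{u} ℚ) ℕ) :=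
  ShortComplex.mk (chainsMap (incl B)) (cokernel.π (chainsMap (incl B))) (cokernel.condition _)

instance mono_incl {Y : Type u} [TopologicalSpace Y] (B : Set Y) : Mono (incl B) :=
  (TopCat.mono_iff_injective _).2 Subtype.val_injective

instance mono_chainsMap {Y Z : TopCat.{u}} (f : Y ⟶ Z) [Mono f] : Mono (chainsMap f) :=
  Functor.map_mono ((AlgebraicTopology.singularChainComplexFunctor (ModuleCat.{u} ℚ)).obj
    (ModuleCat.of ℚ (ULift.{u} ℚ))) f

lemma pairSequence_shortExact {Y : Type u} [TopologicalSpace Y] (B : Set Y) :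
    (pairSequence B).ShortExact where
  exact := ShortComplex.exact_cokernel _
  mono_f := mono_chainsMap _
  epi_g := inferInstanceAs (Epi (cokernel.π _))

/-- A homotopy equivalence of spaces induces a homotopy equivalence of singular chain complexes. -/
def chainsHomotopyEquiv {Y Z : Type u} [TopologicalSpace Y] [TopologicalSpace Z]
    (e : ContinuousMap.HomotopyEquiv Y Z) :
    HomotopyEquiv (chains (TopCat.of Y)) (chains (TopCat.of Z)) where
  hom := chainsMap (TopCat.ofHom e.toFun)
  inv := chainsMap (TopCat.ofHom e.invFun)
  homotopyHomInvId :=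
    (Homotopy.ofEq (Functor.map_comp _ _ _).symm).trans <|
      ((show TopCat.Homotopy (TopCat.ofHom e.toFun ≫ TopCat.ofHom e.invFun) (𝟙 (TopCat.of Y)) from
        e.left_inv.some).singularChainComplexFunctorObjMap _).trans
        (Homotopy.ofEq (CategoryTheory.Functor.map_id _ _))
  homotopyInvHomId :=
    (Homotopy.ofEq (Functor.map_comp _ _ _).symm).trans <|
      ((show TopCat.Homotopy (TopCat.ofHom e.invFun ≫ TopCat.ofHom e.toFun) (𝟙 (TopCat.of Z)) from
        e.right_inv.some).singularChainComplexFunctorObjMap _).trans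
        (Homotopy.ofEq (CategoryTheory.Functor.map_id _ _))

lemma isIso_homologyMap_of_homotopyEquiv {Y Z : Type u} [TopologicalSpace Y] [TopologicalSpace Z]
    (e : ContinuousMap.HomotopyEquiv Y Z) (m : ℕ) :
    IsIso (HomologicalComplex.homologyMap (chainsMap (TopCat.ofHom e.toFun)) m) :=
  inferInstanceAs (IsIso ((chainsHomotopyEquiv e).toHomologyIso m).hom)

/-! ### Homology of a point, of the empty space and of contractible spaces -/

lemma rank_homology_point (m : ℕ) :
    Module.rank ℚ ((chains (TopCat.of PUnit.{u+1})).homology m) = if m = 0 then 1 else 0 := by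
  split_ifs with h
  · subst h
    have : Unique (TopCat.of PUnit.{u+1}) := inferInstanceAs (Unique PUnit)
    refine (AlgebraicTopology.singularHomologyFunctorZeroOfTotallyDisconnectedSpace
        (ModuleCat.{u} ℚ) (ModuleCat.of ℚ (ULift.{u} ℚ)) (TopCat.of PUnit.{u+1}) ≪≫
      coproductUniqueIso _).toLinearEquiv.rank_eq.trans ?_
    change Module.rank ℚ (ULift.{u} ℚ) = 1
    simp
  · rw [rank_zero_iff]
    exact ModuleCat.subsingleton_of_isZero
      (AlgebraicTopology.isZero_singularHomologyFunctor_of_totallyDisconnectedSpace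
        (ModuleCat.{u} ℚ) m (ModuleCat.of ℚ (ULift.{u} ℚ)) (TopCat.of PUnit.{u+1}) h)

lemma rank_homology_empty (Y : Type u) [TopologicalSpace Y] [IsEmpty Y] (m : ℕ) :
    Module.rank ℚ ((chains (TopCat.of Y)).homology m) = 0 := by
  rw [rank_zero_iff]
  by_cases h : m = 0
  · subst h
    have e := (AlgebraicTopology.singularHomologyFunctorZeroOfTotallyDisconnectedSpace
        (ModuleCat.{u} ℚ) (ModuleCat.of ℚ (ULift.{u} ℚ)) (TopCat.of Y))
    refine ModuleCat.subsingleton_of_isZero (IsZero.of_iso ?_ e)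
    have : IsEmpty (TopCat.of Y) := ‹IsEmpty Y›
    rw [IsZero.iff_id_eq_zero]
    ext i
    exact this.elim i
  · exact ModuleCat.subsingleton_of_isZero
      (AlgebraicTopology.isZero_singularHomologyFunctor_of_totallyDisconnectedSpace
        (ModuleCat.{u} ℚ) m (ModuleCat.of ℚ (ULift.{u} ℚ)) (TopCat.of Y) h)

lemma rank_homology_contractible (Y : Type u) [TopologicalSpace Y] [ContractibleSpace Y] (m : ℕ) :
    Module.rank ℚ ((chains (TopCat.of Y)).homology m) = if m = 0 then 1 else 0 := by
  rw [← rank_homology_point.{u} m]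
  obtain ⟨e⟩ := ContractibleSpace.hequiv Y PUnit.{u+1}
  exact ((chainsHomotopyEquiv e).toHomologyIso m).toLinearEquiv.rank_eq

lemma isZero_homology_contractible (Y : Type u) [TopologicalSpace Y] [ContractibleSpace Y] {m : ℕ}
    (hm : m ≠ 0) : IsZero ((chains (TopCat.of Y)).homology m) := by
  have h := rank_homology_contractible Y m
  rw [if_neg hm, rank_zero_iff] at h
  exact ModuleCat.isZero_of_subsingleton _

lemma isZero_homology_empty (Y : Type u) [TopologicalSpace Y] [IsEmpty Y] (m : ℕ) :
    IsZero ((chains (TopCat.of Y)).homology m) := by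
  have h := rank_homology_empty Y m
  rw [rank_zero_iff] at h
  exact ModuleCat.isZero_of_subsingleton _

/-- In a contractible space, every nonempty subspace surjects onto the homology in degree zero. -/
lemma epi_homologyMap_incl {Y : Type u} [TopologicalSpace Y] [ContractibleSpace Y] (B : Set Y)
    (hB : B.Nonempty) (m : ℕ) : Epi (HomologicalComplex.homologyMap (chainsMap (incl B)) m) := by
  obtain ⟨b, hb⟩ := hB
  obtain ⟨e⟩ := ContractibleSpace.hequiv PUnit.{u+1} Y
  -- `Y` is path connected, so the point `b` of `B`, viewed in `Y`, is homotopic to the equivalence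
  -- `e`. The composite through `B` is then an isomorphism on homology, and its second factor is
  -- epi.
  let j : TopCat.of PUnit.{u+1} ⟶ TopCat.of B := TopCat.ofHom ⟨fun _ => ⟨b, hb⟩, continuous_const⟩
  have hH : TopCat.Homotopy (j ≫ incl B) (TopCat.ofHom e.toFun) := by
    have h : ContinuousMap.Homotopic (ContinuousMap.const PUnit.{u+1} b) e.toFun := by
      have h : e.toFun = ContinuousMap.const PUnit.{u+1} (e.toFun ⟨⟩) := by ext; rfl
      rw [h, ContinuousMap.homotopic_const_iff]
      exact PathConnectedSpace.joined _ _
    exact h.some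
  have h1 : HomologicalComplex.homologyMap (chainsMap (j ≫ incl B)) m =
      HomologicalComplex.homologyMap (chainsMap (TopCat.ofHom e.toFun)) m :=
    hH.congr_homologyMap_singularChainComplexFunctor _ m
  have h2 : chainsMap (j ≫ incl B) = chainsMap j ≫ chainsMap (incl B) := Functor.map_comp _ _ _
  have := isIso_homologyMap_of_homotopyEquiv e m
  rw [h2, HomologicalComplex.homologyMap_comp] at h1
  exact epi_of_epi_fac h1

/-- The connecting map is an isomorphism because both neighbouring homology groups of `Y` vanish. -/
lemma rank_homology_pair_succ_succ {Y : Type u} [TopologicalSpace Y] [ContractibleSpace Y]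
    (B : Set Y) (m : ℕ) :
    Module.rank ℚ ((pairSequence B).X₃.homology (m + 2)) =
      Module.rank ℚ ((chains (TopCat.of B)).homology (m + 1)) := by
  have := (pairSequence_shortExact B).isIso_δ (m + 2) (m + 1) rfl
    (isZero_homology_contractible Y (Nat.succ_ne_zero _))
    (isZero_homology_contractible Y (Nat.succ_ne_zero _))
  exact (asIso ((pairSequence_shortExact B).δ (m + 2) (m + 1) rfl)).toLinearEquiv.rank_eq

lemma epi_homologyMap_proj_zero {Y : Type u} [TopologicalSpace Y] (B : Set Y) :
    Epi (HomologicalComplex.homologyMap (pairSequence B).g 0) :=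
  have := (pairSequence_shortExact B).epi_g
  HomologicalComplex.epi_homologyMap_of_epi_of_not_rel _ 0 (by simp)

/-- `H₀(B) → H₀(Y)` is onto, so `H₀(Y) → H₀(Y, B)` is zero; it is also onto. -/
lemma rank_homology_pair_zero {Y : Type u} [TopologicalSpace Y] [ContractibleSpace Y]
    (B : Set Y) (hB : B.Nonempty) :
    Module.rank ℚ ((pairSequence B).X₃.homology 0) = 0 := by
  have hepi : Epi (HomologicalComplex.homologyMap (pairSequence B).f 0) :=
    epi_homologyMap_incl B hB 0
  have hepi' := epi_homologyMap_proj_zero B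
  have h0 : HomologicalComplex.homologyMap (pairSequence B).g 0 = 0 := by
    rw [← cancel_epi (HomologicalComplex.homologyMap (pairSequence B).f 0),
      ← HomologicalComplex.homologyMap_comp, (pairSequence B).zero,
      HomologicalComplex.homologyMap_zero, comp_zero]
  rw [rank_zero_iff]
  exact ModuleCat.subsingleton_of_isZero (IsZero.of_epi_eq_zero _ h0)

/-- As `H₁(Y) = 0`, the connecting map embeds `H₁(Y, B)` as the kernel of the surjection from
`H₀(B)` to the line `H₀(Y)`. -/
lemma rank_homology_pair_one {Y : Type u} [TopologicalSpace Y] [ContractibleSpace Y]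
    (B : Set Y) (hB : B.Nonempty) :
    Module.rank ℚ ((chains (TopCat.of B)).homology 0) =
      1 + Module.rank ℚ ((pairSequence B).X₃.homology 1) := by
  have hS := pairSequence_shortExact B
  have hmono : Mono (hS.δ 1 0 (by simp)) :=
    hS.mono_δ 1 0 rfl (isZero_homology_contractible Y one_ne_zero)
  have hepi := epi_homologyMap_incl B hB 0
  have hex := (hS.homology_exact₁ 1 0 (by simp)).moduleCat_range_eq_ker
  rw [← LinearMap.rank_range_add_rank_ker
    (HomologicalComplex.homologyMap (chainsMap (incl B)) 0).hom]
  congr 1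
  · rw [LinearMap.range_eq_top.2 ((ModuleCat.epi_iff_surjective _).1 hepi), rank_top,
      rank_homology_contractible, if_pos rfl]
  · refine Eq.trans (congrArg (fun p : Submodule ℚ ((chains (TopCat.of B)).homology 0) =>
      Module.rank ℚ p) hex.symm) ?_
    exact (LinearEquiv.ofInjective _ ((ModuleCat.mono_iff_injective _).1 hmono)).rank_eq.symm

lemma rank_homology_pair_empty {Y : Type u} [TopologicalSpace Y] [ContractibleSpace Y]
    (B : Set Y) (hB : B = ∅) (m : ℕ) :
    Module.rank ℚ ((pairSequence B).X₃.homology m) = if m = 0 then 1 else 0 := by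
  subst hB
  have hS := pairSequence_shortExact (∅ : Set Y)
  have hmono : Mono (HomologicalComplex.homologyMap (pairSequence (∅ : Set Y)).g m) :=
    (hS.homology_exact₂ m).mono_g ((isZero_homology_empty _ m).eq_of_src _ _)
  have hepi : Epi (HomologicalComplex.homologyMap (pairSequence (∅ : Set Y)).g m) := by
    rcases m with _ | m
    · exact epi_homologyMap_proj_zero ∅
    · exact (hS.homology_exact₃ (m + 1) m (by simp)).epi_f
        ((isZero_homology_empty _ m).eq_of_tgt _ _)
  have := isIso_of_mono_of_epi (HomologicalComplex.homologyMap (pairSequence (∅ : Set Y)).g m)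
  rw [← rank_homology_contractible Y m]
  exact (asIso (HomologicalComplex.homologyMap
    (pairSequence (∅ : Set Y)).g m)).toLinearEquiv.rank_eq.symm

end RatCoh

/-! ### Rational spheres and contractible pairs -/

open RatCoh

lemma isRationalCohomologySphere_iff_homology (n : ℕ) (Y : Type u) [TopologicalSpace Y] :
    IsRationalCohomologySphere (2 * (n : ℤ) - 1) Y ↔
      ∀ m : ℕ, Module.rank ℚ ((chains (TopCat.of Y)).homology m) =
        (if m = 0 ∧ 0 ≤ 2 * (n : ℤ) - 1 then 1 else 0) +
          (if (m : ℤ) = 2 * (n : ℤ) - 1 then 1 else 0) := by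
  refine forall_congr' fun m => rank_dualCohomology_eq_iff _ _ _ ?_
  split_ifs
  -- Both terms equal to `1` would mean `0 = 2n - 1`, impossible by parity; hence the prescribed
  -- rank is `0` or `1`.
  · omega
  all_goals simp

lemma IsRationalCohomologySphere.iff_of_homotopyEquiv (n : ℕ) {Y Z : Type u} [TopologicalSpace Y]
    [TopologicalSpace Z] (e : ContinuousMap.HomotopyEquiv Y Z) :
    IsRationalCohomologySphere (2 * (n : ℤ) - 1) Y ↔
      IsRationalCohomologySphere (2 * (n : ℤ) - 1) Z := by
  simp_rw [isRationalCohomologySphere_iff_homology,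
    ((chainsHomotopyEquiv e).toHomologyIso _).toLinearEquiv.rank_eq]

/-- The relative cohomology of a pair `(Y, B)` with `Y` contractible is that of a `2n`-ball relative
to its boundary if and only if `B` is a rational cohomology sphere. -/
lemma rank_relH_iff_isRationalCohomologySphere (n : ℕ) {Y : Type u} [TopologicalSpace Y]
    [ContractibleSpace Y] (B : Set Y) :
    (∀ m : ℕ, Module.rank ℚ (relH Y B m) = if m = 2 * n then 1 else 0) ↔
      IsRationalCohomologySphere (2 * (n : ℤ) - 1) B := by
  have h1 : (∀ m : ℕ, Module.rank ℚ (relH Y B m) = if m = 2 * n then 1 else 0) ↔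
      ∀ m : ℕ, Module.rank ℚ ((pairSequence B).X₃.homology m) = if m = 2 * n then 1 else 0 := by
    refine forall_congr' fun m => rank_dualCohomology_eq_iff _ _ _ ?_
    split_ifs <;> simp
  rw [h1, isRationalCohomologySphere_iff_homology]
  rcases B.eq_empty_or_nonempty with hB | hB
  · have : IsEmpty B := Set.isEmpty_coe_sort.2 hB
    simp_rw [rank_homology_pair_empty B hB, rank_homology_empty B]
    -- For `n = 0` both sides hold: the empty set is the sphere of dimension `-1`. For `n > 0`
    -- degree `0` refutes both.
    rcases n with _ | n
    · simp
    · refine iff_of_false (fun h => ?_) (fun h => ?_)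
      · simpa using h 0
      · have := h 0
        rw [if_pos ⟨rfl, by push_cast; omega⟩, if_neg (by push_cast; omega), add_zero] at this
        exact zero_ne_one this
  · have h0 := rank_homology_pair_zero B hB
    have hone := rank_homology_pair_one B hB
    constructor
    · intro h m
      -- `n = 0` would require `H₀(Y, B)` to have rank `1`, but it vanishes as `B` is nonempty.
      have hn : n ≠ 0 := by
        rintro rfl
        rw [h 0, mul_zero, if_pos rfl] at h0
        exact one_ne_zero h0
      rcases m with _ | m
      · rw [hone, h 1, if_neg (by omega), if_pos ⟨rfl, by omega⟩, if_neg (by omega)]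
      · rw [← rank_homology_pair_succ_succ B m, h, if_neg (by omega : ¬(m + 1 = 0 ∧ _)), zero_add]
        exact if_congr (by omega) rfl rfl
    · intro h m
      have hn : n ≠ 0 := by
        rintro rfl
        have := h 0
        rw [hone, if_neg (by omega), if_neg (by omega), add_zero] at this
        exact one_ne_zero (add_eq_zero.1 this).1
      rcases m with _ | _ | m
      · rw [h0, if_neg (by omega)]
      · have := h 0
        rw [hone, if_pos ⟨rfl, by omega⟩, if_neg (by omega)] at this
        rw [zero_add, if_neg (by omega)]
        -- Cancelling a summand from cardinals requires it to be finite.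
        exact Cardinal.eq_of_add_eq_add_left this Cardinal.one_lt_aleph0
      · rw [rank_homology_pair_succ_succ B m, h, if_neg (by omega : ¬(m + 1 = 0 ∧ _)), zero_add]
        exact if_congr (by omega) rfl rfl

/-! ### Weights of regular functions under a one-parameter subgroup -/

namespace LaurentPolynomial

lemma map_eval₂ {R S S' : Type*} [CommRing R] [CommRing S] [CommRing S'] (f : R →+* S) (u : Sˣ)
    (φ : S →+* S') (p : LaurentPolynomial R) :
    φ (eval₂ f u p) = eval₂ (φ.comp f) (Units.map φ u) p := by
  induction p using LaurentPolynomial.induction_on' with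
  | add p q hp hq => simp only [map_add, hp, hq]
  | C_mul_T n a =>
    have h : φ ((u ^ n : Sˣ) : S) = ((Units.map φ u ^ n : S'ˣ) : S') :=
      congrArg Units.val (map_zpow (Units.map (φ : S →* S')) u n)
    rw [eval₂_C_mul_T, eval₂_C_mul_T, map_mul, h, RingHom.comp_apply]

lemma eval₂_eq_sum {R S : Type*} [CommRing R] [CommRing S] (f : R →+* S) (u : Sˣ)
    (p : LaurentPolynomial R) :
    eval₂ f u p = p.coeff.sum fun k a => f a * ((u ^ k : Sˣ) : S) := by
  induction p using LaurentPolynomial.induction_on' with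
  | add p q hp hq =>
    rw [map_add, hp, hq, AddMonoidAlgebra.coeff_add, Finsupp.sum_add_index'] <;> simp [add_mul]
  | C_mul_T n a =>
    rw [eval₂_C_mul_T, ← single_eq_C_mul_T, AddMonoidAlgebra.coeff_single, Finsupp.sum_single_index]
    simp

end LaurentPolynomial

/-- The characters `t ↦ t ^ k` of `ℂ^*` are linearly independent. -/
lemma Complex.linearIndependent_zpow :
    LinearIndependent ℂ (fun (k : ℤ) (t : ℂˣ) => ((t ^ k : ℂˣ) : ℂ)) := by
  refine (linearIndependent_monoidHom ℂˣ ℂ).comp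
    (fun k : ℤ => (Units.coeHom ℂ).comp (zpowGroupHom k)) fun k l h => ?_
  -- Evaluation at `2` already separates the characters.
  have h2 := DFunLike.congr_fun h (Units.mk0 (2 : ℂ) two_ne_zero)
  have h3 : ((2 : ℝ) : ℂ) ^ k = ((2 : ℝ) : ℂ) ^ l := by simpa using h2
  exact zpow_right_injective₀ two_pos (by norm_num) (by exact_mod_cast h3 : (2 : ℝ) ^ k = 2 ^ l)

/-! ### The Nullstellensatz -/

namespace ComplexPoints

variable {A : Type u} [CommRing A] [Algebra ℂ A]

/-- The weak Nullstellensatz: a finitely generated nonzero algebra has a complex point. -/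
lemma nonempty_of_finiteType [Algebra.FiniteType ℂ A] [Nontrivial A] :
    Nonempty (ComplexPoints A) := by
  obtain ⟨m, hm⟩ := Ideal.exists_maximal A
  let _ := Ideal.Quotient.field m
  have : Module.Finite ℂ (A ⧸ m) := finite_of_finite_type_of_isJacobsonRing ℂ (A ⧸ m)
  let e := AlgEquiv.ofBijective (Algebra.ofId ℂ (A ⧸ m))
    IsAlgClosed.algebraMap_bijective_of_isIntegral
  exact ⟨(e.symm : (A ⧸ m) →ₐ[ℂ] ℂ).comp (Ideal.Quotient.mkₐ ℂ m)⟩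

/-- The Nullstellensatz: a regular function on a variety that vanishes at all points is zero. -/
lemma eq_zero_of_eval_eq_zero [IsDomain A] [Algebra.FiniteType ℂ A] (a : A)
    (h : ∀ x : ComplexPoints A, x.eval a = 0) : a = 0 := by
  by_contra ha
  -- Rabinowitsch's trick: a complex point of `A[1/a]`, which is nonzero, restricts to a point of
  -- `A` at which `a` does not vanish.
  have := IsLocalization.Away.finitePresentation (S := Localization.Away a) a
  have : Algebra.FiniteType ℂ (Localization.Away a) :=
    Algebra.FiniteType.trans (S := A) inferInstance inferInstance
  have : Nontrivial (Localization.Away a) :=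
    (IsLocalization.isDomain_localization
      (powers_le_nonZeroDivisors_of_noZeroDivisors ha)).toNontrivial
  obtain ⟨y⟩ := nonempty_of_finiteType (A := Localization.Away a)
  have hu := (IsLocalization.Away.algebraMap_isUnit (S := Localization.Away a) a).map y.eval
  have hx := h ((y.eval).comp (IsScalarTower.toAlgHom ℂ A (Localization.Away a)))
  exact hu.ne_zero hx

end ComplexPoints

/-! ### Weight decomposition and positivity of weights -/

section Weights

variable {A : Type u} [CommRing A] [Algebra ℂ A] {r : ℕ} [MulAction (Torus r) (ComplexPoints A)]

/-- A regular function is homogeneous of weight `k` for the action through `lam`. -/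
def IsHomogeneousOfWeight (lam : ℂˣ →* Torus r) (k : ℤ) (g : A) : Prop :=
  ∀ (t : ℂˣ) (x : ComplexPoints A), (lam t • x).eval g = x.eval g * ((t ^ k : ℂˣ) : ℂ)

lemma exists_laurent_eval_smul (hact : IsAlgebraicAction r A) {lam : ℂˣ →* Torus r}
    (hlam : IsOneParameterSubgroup lam) (f : A) :
    ∃ G : ℤ →₀ A, ∀ (t : ℂˣ) (x : ComplexPoints A),
      (lam t • x).eval f = G.sum fun k a => x.eval a * ((t ^ k : ℂˣ) : ℂ) := by
  obtain ⟨F, hF⟩ := hact f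
  choose p hp using hlam
  let c : ℂ →+* LaurentPolynomial A := LaurentPolynomial.C.comp (algebraMap ℂ A)
  let T : (LaurentPolynomial A)ˣ := (LaurentPolynomial.isUnit_T 1).unit
  -- The inverse coordinates are replaced by `p i` at `T⁻¹`, since `λ(t)⁻¹ = λ(t⁻¹)`; no Laurent
  -- polynomial has to be inverted.
  let G : LaurentPolynomial A := F.eval₂ LaurentPolynomial.C (Sum.elim
    (fun i => LaurentPolynomial.eval₂ c T (p i)) (fun i => LaurentPolynomial.eval₂ c T⁻¹ (p i)))
  refine ⟨G.coeff, fun t x => ?_⟩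
  have hT : Units.map (LaurentPolynomial.eval₂ (x.eval : A →+* ℂ) t : _ →* ℂ) T = t := by
    ext
    simp [T]
  have hc : (LaurentPolynomial.eval₂ (x.eval : A →+* ℂ) t).comp c = RingHom.id ℂ := by
    ext z
    simp [c]
  have h := LaurentPolynomial.eval₂_eq_sum (x.eval : A →+* ℂ) t G
  refine (hF (lam t) x).trans (Eq.trans ?_ h)
  rw [MvPolynomial.hom_eval₂]
  congr 1
  · ext a
    simp
  · ext i
    rcases i with i | i
    · simp only [Sum.elim_inl]
      rw [LaurentPolynomial.map_eval₂, hc]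
      erw [hT]
      exact hp i t
    · simp only [Sum.elim_inr]
      rw [LaurentPolynomial.map_eval₂, hc, map_inv]
      erw [hT]
      rw [← hp i t⁻¹, map_inv]
      rfl

/-- Every regular function is a finite sum of homogeneous ones. -/
lemma exists_homogeneous_decomposition (hact : IsAlgebraicAction r A) {lam : ℂˣ →* Torus r}
    (hlam : IsOneParameterSubgroup lam) (f : A) :
    ∃ G : ℤ →₀ A, (∀ x : ComplexPoints A, x.eval f = G.sum fun _ a => x.eval a) ∧
      ∀ k, IsHomogeneousOfWeight lam k (G k) := by
  obtain ⟨G, hG⟩ := exists_laurent_eval_smul hact hlam f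
  refine ⟨G, fun x => by simpa using hG 1 x, fun k s x => ?_⟩
  have key := Complex.linearIndependent_zpow
  rw [linearIndependent_iff'] at key
  -- Expand `f(λ(ts)x)` in powers of `t` in two ways, at the point `λ(s)x` and at `x`; independence
  -- of the characters lets the coefficients be compared.
  have h := key G.support (fun l => (lam s • x).eval (G l) - x.eval (G l) * ((s ^ l : ℂˣ) : ℂ)) (by
    ext t
    have h1 := hG t (lam s • x)
    rw [← mul_smul, ← map_mul, hG (t * s) x] at h1
    simp only [Finset.sum_apply, Pi.smul_apply, smul_eq_mul, sub_mul, Finset.sum_sub_distrib,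
      Pi.zero_apply]
    rw [sub_eq_zero]
    refine h1.symm.trans (Finset.sum_congr rfl fun l _ => ?_)
    simp only [mul_zpow, Units.val_mul]
    ring) k
  by_cases hk : k ∈ G.support
  · exact sub_eq_zero.1 (h hk)
  · rw [Finsupp.notMem_support_iff.1 hk]
    simp

instance comap_coe_units_neBot :
    (comap (fun t : ℂˣ => (t : ℂ)) (𝓝 0)).NeBot := by
  rw [comap_neBot_iff_frequently]
  have h : ∃ᶠ z : ℂ in 𝓝 0, z ≠ 0 := frequently_iff_neBot.2 (NormedField.nhdsNE_neBot (0 : ℂ))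
  exact h.mono fun z hz => ⟨Units.mk0 z hz, rfl⟩

lemma ComplexPoints.continuous_eval (f : A) : Continuous fun x : ComplexPoints A => x.eval f :=
  (continuous_apply f).comp continuous_induced_dom

/-- Homogeneous functions of weight `≤ 0` are constant on an attracted variety. -/
lemma IsHomogeneousOfWeight.eq_algebraMap [IsDomain A] [Algebra.FiniteType ℂ A]
    {lam : ℂˣ →* Torus r} {x₀ : ComplexPoints A} (hattr : IsAttractedBy lam x₀) {k : ℤ}
    (hk : k ≤ 0) {g : A} (hg : IsHomogeneousOfWeight lam k g) :
    ∃ c : ℂ, g = algebraMap ℂ A c := by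
  obtain ⟨f, hf, hlim⟩ := hattr
  obtain ⟨m, rfl⟩ : ∃ m : ℕ, k = -m := ⟨k.natAbs, by omega⟩
  -- With `0 ^ 0 = 1`, this constant is `g(x₀)` in weight zero and `0` in negative weight.
  refine ⟨(0 : ℂ) ^ m * x₀.eval g, ?_⟩
  -- The limit is known only where `f ≠ 0`. Multiplying by `f` gives an identity at all points, and
  -- `f` is then cancelled in the domain `A`.
  have h : (g - algebraMap ℂ A ((0 : ℂ) ^ m * x₀.eval g)) * f = 0 := by
    refine ComplexPoints.eq_zero_of_eval_eq_zero _ fun y => ?_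
    rw [map_mul, map_sub, AlgHom.commutes]
    by_cases hy : y.eval f = 0
    · rw [hy, mul_zero]
    have h1 : Tendsto (fun t : ℂˣ => (t : ℂ) ^ m * (lam t • y).eval g)
        (comap (fun t : ℂˣ => (t : ℂ)) (𝓝 0)) (𝓝 ((0 : ℂ) ^ m * x₀.eval g)) :=
      (tendsto_comap.pow m).mul (((ComplexPoints.continuous_eval g).tendsto x₀).comp (hlim y hy))
    have h2 : (fun t : ℂˣ => (t : ℂ) ^ m * (lam t • y).eval g) = fun _ => y.eval g := by
      ext t
      rw [hg t y, mul_left_comm]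
      simp
    rw [h2] at h1
    rw [tendsto_nhds_unique tendsto_const_nhds h1]
    simp
  have hf0 : f ≠ 0 := by
    rintro rfl
    exact hf (map_zero _)
  exact sub_eq_zero.1 ((mul_eq_zero.1 h).resolve_right hf0)

/-- The coordinate ring of an attracted variety is generated by finitely many homogeneous functions
of positive weights. -/
lemma exists_homogeneous_generators [IsDomain A] [Algebra.FiniteType ℂ A]
    (hact : IsAlgebraicAction r A) {lam : ℂˣ →* Torus r}
    (hlam : IsOneParameterSubgroup lam) {x₀ : ComplexPoints A} (hattr : IsAttractedBy lam x₀) :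
    ∃ (ι : Type u) (_ : Finite ι) (a : ι → A) (d : ι → ℕ), (∀ i, d i ≠ 0) ∧
      (∀ i, IsHomogeneousOfWeight lam (d i) (a i)) ∧ Algebra.adjoin ℂ (Set.range a) = ⊤ := by
  obtain ⟨S, hS⟩ := (inferInstance : Algebra.FiniteType ℂ A).out
  choose G hG hGhom using exists_homogeneous_decomposition hact hlam (A := A)
  -- Only components of positive weight are kept; the others are constants and lie in every
  -- subalgebra.
  let I : Set (A × ℕ) := {p | p.2 ≠ 0 ∧ ∃ f ∈ S, (p.2 : ℤ) ∈ (G f).support ∧ p.1 = G f p.2}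
  refine ⟨I, ?_, fun p => p.1.1, fun p => p.1.2, fun p => p.2.1, ?_, ?_⟩
  · have : I ⊆ ⋃ f ∈ S, (fun k : ℤ => (G f k, k.toNat)) '' ((G f).support : Set ℤ) := by
      rintro ⟨b, k⟩ ⟨-, f, hf, hk, hb⟩
      simp only [Set.mem_iUnion]
      exact ⟨f, hf, k, hk, by simp_all⟩
    exact (Set.Finite.subset (S.finite_toSet.biUnion fun f _ =>
      (Finset.finite_toSet _).image _) this).to_subtype
  · rintro ⟨⟨b, k⟩, -, f, hf, hk, hb⟩
    dsimp only at hb ⊢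
    rw [hb]
    exact hGhom f k
  · rw [eq_top_iff, ← hS, Algebra.adjoin_le_iff]
    intro f hf
    have h : f = (G f).sum fun _ a => a := by
      refine sub_eq_zero.1 (ComplexPoints.eq_zero_of_eval_eq_zero _ fun x => ?_)
      rw [map_sub, hG f x, Finsupp.sum, Finsupp.sum, map_sum, sub_self]
    rw [h]
    refine Subalgebra.sum_mem _ fun k hk => ?_
    rcases le_or_gt k 0 with hk0 | hk0
    · obtain ⟨c, hc⟩ := (hGhom f k).eq_algebraMap hattr hk0
      rw [hc]
      exact Subalgebra.algebraMap_mem _ c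
    · obtain ⟨m, rfl⟩ := Int.eq_ofNat_of_zero_le hk0.le
      exact Algebra.subset_adjoin ⟨⟨(G f m, m), by dsimp only; omega, f, hf, hk, rfl⟩, rfl⟩

end Weights

/-! ### The topology of an attractive fixed point -/

namespace ComplexPoints

variable {A : Type u} [CommRing A] [Algebra ℂ A] {ι : Type u} {a : ι → A}

/-- The values at a point of a family of regular functions. -/
def coords (a : ι → A) (x : ComplexPoints A) : ι → ℂ := fun i => x.eval (a i)

lemma continuous_coords (a : ι → A) : Continuous (coords a) :=
  continuous_pi fun i => continuous_eval (a i)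

lemma aeval_surjective (ha : Algebra.adjoin ℂ (Set.range a) = ⊤) :
    Function.Surjective (MvPolynomial.aeval (R := ℂ) a) := by
  rw [← AlgHom.range_eq_top, ← Algebra.adjoin_range_eq_range_aeval, ha]

lemma eval_aeval (x : ComplexPoints A) (p : MvPolynomial ι ℂ) :
    x.eval (MvPolynomial.aeval a p) = MvPolynomial.aeval (coords a x) p := by
  rw [← AlgHom.comp_apply, MvPolynomial.comp_aeval]
  rfl

lemma coords_injective (ha : Algebra.adjoin ℂ (Set.range a) = ⊤) :
    Function.Injective (coords a) := by
  intro x y h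
  refine AlgHom.ext fun f => ?_
  obtain ⟨p, rfl⟩ := aeval_surjective ha f
  exact (eval_aeval x p).trans ((congrArg (fun v => MvPolynomial.aeval v p) h).trans
    (eval_aeval y p).symm)

lemma continuous_aeval (p : MvPolynomial ι ℂ) :
    Continuous fun v : ι → ℂ => MvPolynomial.aeval v p := by
  simp_rw [MvPolynomial.aeval_eq_eval]
  exact MvPolynomial.continuous_eval p

/-- Generators of the coordinate ring embed the variety as a closed subset of an affine space. -/
lemma isClosedEmbedding_coords (ha : Algebra.adjoin ℂ (Set.range a) = ⊤) :
    IsClosedEmbedding (coords a) where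
  injective := coords_injective ha
  eq_induced := by
    refine le_antisymm (continuous_iff_le_induced.1 (continuous_coords a)) ?_
    refine continuous_iff_le_induced.1 ?_
    let _ := TopologicalSpace.induced (coords a) inferInstance
    refine continuous_pi fun f => ?_
    obtain ⟨p, rfl⟩ := aeval_surjective ha f
    simp_rw [eval_aeval]
    exact (continuous_aeval p).comp continuous_induced_dom
  isClosed_range := by
    -- The image is cut out by the relations among the generators: a vector satisfying them all
    -- defines a homomorphism from the quotient, that is, a point.
    have h : Set.range (coords a) = ⋂ p ∈ RingHom.ker (MvPolynomial.aeval (R := ℂ) a),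
        {v : ι → ℂ | MvPolynomial.aeval v p = 0} := by
      ext v
      simp only [Set.mem_iInter, Set.mem_range, Set.mem_ofPred_eq]
      constructor
      · rintro ⟨x, rfl⟩ p hp
        rw [← eval_aeval, (RingHom.mem_ker).1 hp, map_zero]
      · intro hv
        let e := Ideal.quotientKerAlgEquivOfSurjective (aeval_surjective ha)
        let y : (MvPolynomial ι ℂ ⧸ RingHom.ker (MvPolynomial.aeval (R := ℂ) a)) →ₐ[ℂ] ℂ :=
          Ideal.Quotient.liftₐ _ (MvPolynomial.aeval v) hv
        refine ⟨y.comp (e.symm : A →ₐ[ℂ] _), ?_⟩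
        ext i
        have h1 : e.symm (a i) = Ideal.Quotient.mk _ (MvPolynomial.X i) := by
          rw [AlgEquiv.symm_apply_eq]
          exact (MvPolynomial.aeval_X a i).symm
        change y (e.symm (a i)) = v i
        rw [h1]
        exact MvPolynomial.aeval_X v i
    rw [h]
    exact isClosed_biInter fun p _ => isClosed_eq (continuous_aeval p) continuous_const

end ComplexPoints

open scoped NNReal unitInterval

/-! ### Scaling by nonnegative reals and the radial function -/

section Scaling

variable {A : Type u} [CommRing A] [Algebra ℂ A] {r : ℕ} [MulAction (Torus r) (ComplexPoints A)]

/-- The action of the positive real numbers through `lam`, extended by `0 • x = x₀`. -/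
def scale (lam : ℂˣ →* Torus r) (x₀ : ComplexPoints A) (s : ℝ≥0) (x : ComplexPoints A) :
    ComplexPoints A :=
  if h : 0 < s then lam (posUnit ⟨s, h⟩) • x else x₀

/-- A continuous function that is homogeneous of degree one for the scaling, together with the
properties of the scaling. -/
structure IsRadial (lam : ℂˣ →* Torus r) (x₀ : ComplexPoints A) (φ : ComplexPoints A → ℝ≥0) :
    Prop where
  continuous : Continuous φ
  map_scale : ∀ s x, φ (scale lam x₀ s x) = s * φ x
  eq_zero_iff : ∀ x, φ x = 0 ↔ x = x₀
  isCompact : IsCompact (φ ⁻¹' {1})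
  continuous_scale : Continuous fun p : ℝ≥0 × ComplexPoints A => scale lam x₀ p.1 p.2

/-- The exponent `1/d_i` turns each `|a_i|`, of degree `d_i`, into a function of degree one, so that
the sum scales by `s`. -/
lemma exists_isRadial [IsDomain A] [Algebra.FiniteType ℂ A]
    (hact : IsAlgebraicAction r A) {x₀ : ComplexPoints A} (hfix : ∀ t : Torus r, t • x₀ = x₀)
    {lam : ℂˣ →* Torus r} (hlam : IsOneParameterSubgroup lam) (hattr : IsAttractedBy lam x₀) :
    ∃ φ, IsRadial lam x₀ φ := by
  obtain ⟨ι, hι, a, d, hd, hhom, ha⟩ := exists_homogeneous_generators hact hlam hattr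
  have _ := Fintype.ofFinite ι
  have hemb := ComplexPoints.isClosedEmbedding_coords ha
  -- Invariance of `x₀` under `λ(2)` gives `a_i(x₀) = 2^(d_i) a_i(x₀)`, with `d_i > 0`.
  have hzero (i : ι) : x₀.eval (a i) = 0 := by
    have h := hhom i (Units.mk0 2 two_ne_zero) x₀
    rw [hfix] at h
    have h2 : (2 : ℂ) ^ d i ≠ 1 := by
      have : (1 : ℝ) < 2 ^ d i := one_lt_pow₀ one_lt_two (hd i)
      exact_mod_cast this.ne'
    have h3 : x₀.eval (a i) * (1 - (2 : ℂ) ^ d i) = 0 := by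
      rw [mul_sub, mul_one, sub_eq_zero]
      simpa using h
    exact (mul_eq_zero.1 h3).resolve_right (sub_ne_zero.2 h2.symm)
  have hscale (s : ℝ≥0) (x : ComplexPoints A) (i : ι) :
      (scale lam x₀ s x).eval (a i) = ((s : ℝ) : ℂ) ^ d i * x.eval (a i) := by
    unfold scale
    split_ifs with h
    · rw [hhom i, mul_comm]
      simp [posUnit]
    -- At `s = 0` the formula agrees with the value `x₀`, because `a_i(x₀) = 0` and `0^(d_i) = 0`.
    · have : s = 0 := by simpa using h
      simp [this, hzero, hd i]
  let ψ : (ι → ℂ) → ℝ≥0 := fun v => ∑ i, ‖v i‖₊ ^ ((d i : ℝ)⁻¹)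
  have hψ : Continuous ψ := continuous_finsetSum _ fun i _ =>
    (NNReal.continuous_rpow_const (by positivity)).comp (continuous_apply i).nnnorm
  refine ⟨fun x => ψ (ComplexPoints.coords a x), hψ.comp hemb.continuous, ?_, ?_, ?_, ?_⟩
  · intro s x
    simp only [ψ, ComplexPoints.coords, hscale, Finset.mul_sum]
    refine Finset.sum_congr rfl fun i _ => ?_
    rw [nnnorm_mul, nnnorm_pow, NNReal.mul_rpow, NNReal.pow_rpow_inv_natCast _ (hd i)]
    simp
  · intro x
    have h1 : x = x₀ ↔ ∀ i, x.eval (a i) = 0 := by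
      rw [← hemb.injective.eq_iff, funext_iff]
      simp only [ComplexPoints.coords, hzero]
    rw [h1]
    simp only [ψ, Finset.sum_eq_zero_iff, Finset.mem_univ, true_imp_iff]
    refine forall_congr' fun i => ?_
    rw [NNReal.rpow_eq_zero (by simpa using hd i), nnnorm_eq_zero]
    rfl
  · refine hemb.isCompact_preimage (K := ψ ⁻¹' {1}) ?_
    refine Metric.isCompact_of_isClosed_isBounded (isClosed_singleton.preimage hψ) ?_
    refine (Metric.isBounded_closedBall (x := (0 : ι → ℂ)) (r := 1)).subset fun v hv => ?_
    rw [mem_closedBall_zero_iff, pi_norm_le_iff_of_nonneg zero_le_one]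
    intro i
    -- The terms are nonnegative with sum `1`, so each is at most `1`; hence so is each `‖v i‖`.
    have h1 : ‖v i‖₊ ^ ((d i : ℝ)⁻¹) ≤ 1 := by
      rw [← (hv : ψ v = 1)]
      exact Finset.single_le_sum (f := fun i => ‖v i‖₊ ^ ((d i : ℝ)⁻¹)) (fun _ _ => zero_le)
        (Finset.mem_univ i)
    have h2 := pow_le_one' h1 (d i)
    rwa [NNReal.rpow_inv_natCast_pow _ (hd i)] at h2
  · rw [hemb.isInducing.continuous_iff]
    refine continuous_pi fun i => ?_
    simp only [Function.comp_def, ComplexPoints.coords, hscale]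
    have := ComplexPoints.continuous_eval (a i)
    fun_prop

variable {lam : ℂˣ →* Torus r} {x₀ : ComplexPoints A}

lemma scale_zero (x : ComplexPoints A) : scale lam x₀ 0 x = x₀ := by
  simp [scale]

lemma posUnit_eq_one (s : Set.Ioi (0 : ℝ)) (hs : (s : ℝ) = 1) : posUnit s = 1 := by
  ext
  simp [posUnit, hs]

lemma scale_of_pos {s : Set.Ioi (0 : ℝ)} (x : ComplexPoints A) :
    scale lam x₀ (Real.toNNReal s) x = lam (posUnit s) • x := by
  rw [scale, dif_pos (Real.toNNReal_pos.2 s.2)]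
  congr 2
  ext
  simp [posUnit, (Set.mem_Ioi.1 s.2).le]

lemma scale_one (x : ComplexPoints A) : scale lam x₀ 1 x = x := by
  rw [scale, dif_pos one_pos, posUnit_eq_one _ rfl, map_one, one_smul]

lemma scale_scale {s t : ℝ≥0} (hs : 0 < s) (ht : 0 < t) (x : ComplexPoints A) :
    scale lam x₀ s (scale lam x₀ t x) = scale lam x₀ (s * t) x := by
  rw [scale, scale, scale, dif_pos hs, dif_pos ht, dif_pos (mul_pos hs ht), ← mul_smul, ← map_mul]
  congr 2
  ext
  simp [posUnit]

/-! ### Contraction, section and polar coordinates -/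

namespace IsRadial

variable {φ : ComplexPoints A → ℝ≥0} (hφ : IsRadial lam x₀ φ)
include hφ

lemma pos (x : Punctured x₀) : 0 < φ x :=
  pos_iff_ne_zero.2 fun h => x.2 ((hφ.eq_zero_iff _).1 h)

lemma scale_ne {s : ℝ≥0} (hs : 0 < s) (x : Punctured x₀) : scale lam x₀ s x ∈ ({x₀}ᶜ : Set _) := by
  intro h
  have h1 := hφ.map_scale s x
  rw [(hφ.eq_zero_iff _).2 h] at h1
  exact (mul_pos hs (hφ.pos x)).ne h1

/-- Scaling by `s` from `0` to `1` joins the constant map at `x₀` to the identity. -/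
lemma contractibleSpace : ContractibleSpace (ComplexPoints A) := by
  rw [contractible_iff_id_nullhomotopic]
  refine ⟨x₀, ContinuousMap.Homotopic.symm
    ⟨⟨⟨fun p => scale lam x₀ (unitInterval.toNNReal p.1) p.2, ?_⟩, ?_, ?_⟩⟩⟩
  · exact hφ.continuous_scale.comp
      ((unitInterval.toNNReal_continuous.comp continuous_fst).prodMk continuous_snd)
  · intro x
    simpa using scale_zero x
  · intro x
    simpa using scale_one x

/-- The point of the orbit of `x` at which `φ` is one. -/
def normalize (x : Punctured x₀) : Punctured x₀ :=
  ⟨scale lam x₀ (φ x)⁻¹ x, hφ.scale_ne (inv_pos.2 (hφ.pos x)) x⟩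

lemma continuous_normalize : Continuous hφ.normalize := by
  refine Continuous.subtype_mk
    (hφ.continuous_scale.comp (Continuous.prodMk ?_ continuous_subtype_val)) _
  exact (hφ.continuous.comp continuous_subtype_val).inv₀ fun x => (hφ.pos x).ne'

lemma map_normalize (x : Punctured x₀) : φ (hφ.normalize x) = 1 :=
  (hφ.map_scale _ _).trans (inv_mul_cancel₀ (hφ.pos x).ne')

lemma scale_normalize (x : Punctured x₀) : scale lam x₀ (φ x) (hφ.normalize x) = x := by
  have := hφ.pos x
  rw [normalize, scale_scale this (inv_pos.2 this), mul_inv_cancel₀ this.ne', scale_one]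

/-- Constancy along orbits is what lets the normalization descend to a section on the link. -/
lemma normalize_scale {s : ℝ≥0} (hs : 0 < s) (x : Punctured x₀) :
    hφ.normalize ⟨scale lam x₀ s x, hφ.scale_ne hs x⟩ = hφ.normalize x := by
  apply Subtype.ext
  have := hφ.pos x
  simp only [normalize, hφ.map_scale]
  rw [scale_scale (inv_pos.2 (mul_pos hs this)) hs, mul_inv_rev, inv_mul_cancel_right₀ hs.ne']

omit hφ in
lemma linkProj_scale {s : ℝ≥0} (hs : 0 < s) (x : Punctured x₀) (h) :
    linkProj lam x₀ ⟨scale lam x₀ s x, h⟩ = linkProj lam x₀ x := by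
  refine Quotient.sound ((linkSetoid lam x₀).symm ⟨⟨s, hs⟩, ?_⟩)
  exact (dif_pos (t := fun h : 0 < s => lam (posUnit ⟨s, h⟩) • (x : ComplexPoints A)) hs).symm

lemma linkProj_normalize (x : Punctured x₀) :
    linkProj lam x₀ (hφ.normalize x) = linkProj lam x₀ x :=
  linkProj_scale (inv_pos.2 (hφ.pos x)) x _

/-- The section of the quotient map whose values are the points at which `φ` is one. -/
def linkSection : C(Link lam x₀, Punctured x₀) where
  toFun := Quotient.lift hφ.normalize (by
    rintro x y ⟨s, hs⟩
    have h : y = ⟨scale lam x₀ (Real.toNNReal s) x, hφ.scale_ne (Real.toNNReal_pos.2 s.2) x⟩ :=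
      Subtype.ext (hs.symm.trans (scale_of_pos _).symm)
    rw [h, hφ.normalize_scale (Real.toNNReal_pos.2 s.2)])
  continuous_toFun := hφ.continuous_normalize.quotient_lift _

lemma linkSection_linkProj (x : Punctured x₀) :
    hφ.linkSection (linkProj lam x₀ x) = hφ.normalize x := rfl

omit hφ in
lemma linkProj_surjective : Function.Surjective (linkProj lam x₀) := Quotient.mk_surjective

lemma linkProj_comp_linkSection :
    (linkProj lam x₀).comp hφ.linkSection = ContinuousMap.id (Link lam x₀) := by
  ext l
  obtain ⟨x, rfl⟩ := linkProj_surjective l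
  exact hφ.linkProj_normalize x

lemma map_linkSection (l : Link lam x₀) : φ (hφ.linkSection l) = 1 := by
  obtain ⟨x, rfl⟩ := linkProj_surjective l
  exact hφ.map_normalize x

/-- The compact level set `φ = 1` avoids `x₀` and meets every orbit, so it maps onto the link. -/
lemma compactSpace_link : CompactSpace (Link lam x₀) := by
  have hK : IsCompact ((↑) ⁻¹' (φ ⁻¹' {1}) : Set (Punctured x₀)) := by
    rw [Subtype.isCompact_iff, Subtype.image_preimage_coe, Set.inter_eq_self_of_subset_right]
    · exact hφ.isCompact
    · rintro x hx rfl
      rw [Set.mem_preimage, (hφ.eq_zero_iff x).2 rfl] at hx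
      exact zero_ne_one hx
  refine ⟨?_⟩
  have h : (Set.univ : Set (Link lam x₀)) ⊆ linkProj lam x₀ '' ((↑) ⁻¹' (φ ⁻¹' {1})) := by
    intro l _
    exact ⟨hφ.linkSection l, hφ.map_linkSection l,
      DFunLike.congr_fun hφ.linkProj_comp_linkSection l⟩
  rw [Set.univ_subset_iff.1 h |>.symm]
  exact hK.image (linkProj lam x₀).continuous

/-- Polar coordinates on the complement of the attractive fixed point. -/
def polarHomeomorph : Punctured x₀ ≃ₜ Link lam x₀ × Set.Ioi (0 : ℝ) where
  toFun x := (linkProj lam x₀ x, ⟨φ x, hφ.pos x⟩)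
  invFun p := ⟨scale lam x₀ (Real.toNNReal p.2) (hφ.linkSection p.1),
    hφ.scale_ne (Real.toNNReal_pos.2 p.2.2) _⟩
  left_inv x := Subtype.ext <|
    (congrArg (fun s => scale lam x₀ s (hφ.normalize x)) Real.toNNReal_coe).trans
      (hφ.scale_normalize x)
  right_inv := by
    rintro ⟨l, s⟩
    refine Prod.ext ?_ (Subtype.ext ?_)
    · exact (linkProj_scale (Real.toNNReal_pos.2 s.2) _ _).trans
        (DFunLike.congr_fun hφ.linkProj_comp_linkSection l)
    · simp [hφ.map_scale, hφ.map_linkSection, (Set.mem_Ioi.1 s.2).le]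
  continuous_toFun := by
    have := hφ.continuous
    fun_prop
  continuous_invFun := by
    refine Continuous.subtype_mk (hφ.continuous_scale.comp (Continuous.prodMk ?_ ?_)) _
    · fun_prop
    · fun_prop

/-- Scale `x` by `(1 - t) + t φ(x)⁻¹`, which runs from `1` to the normalizing factor. On the image
of the section `φ = 1`, so the factor stays `1`. -/
lemma homotopicRel :
    (ContinuousMap.id (Punctured x₀)).HomotopicRel (hφ.linkSection.comp (linkProj lam x₀))
      (Set.range hφ.linkSection) := by
  have hpos (t : I) (x : Punctured x₀) :
      0 < unitInterval.toNNReal (unitInterval.symm t) + unitInterval.toNNReal t * (φ x)⁻¹ := by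
    have := inv_pos.2 (hφ.pos x)
    rcases eq_or_ne t 0 with rfl | ht
    · simp
    · have : 0 < unitInterval.toNNReal t := unitInterval.pos_iff_ne_zero.2 ht
      positivity
  refine ⟨⟨⟨⟨fun p => ⟨scale lam x₀ _ p.2, hφ.scale_ne (hpos p.1 p.2) p.2⟩, ?_⟩, ?_, ?_⟩, ?_⟩⟩
  · refine Continuous.subtype_mk (hφ.continuous_scale.comp (Continuous.prodMk ?_ (by fun_prop))) _
    have : Continuous fun p : I × Punctured x₀ => (φ p.2)⁻¹ :=
      (hφ.continuous.comp (by fun_prop)).inv₀ fun p => (hφ.pos p.2).ne'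
    fun_prop
  · intro x
    apply Subtype.ext
    simp [scale_one]
  · intro x
    apply Subtype.ext
    simp [hφ.linkSection_linkProj, normalize]
  · rintro t _ ⟨l, rfl⟩
    apply Subtype.ext
    simp [hφ.map_linkSection, scale_one]

/-- The complement of the attractive fixed point is homotopy equivalent to its link. -/
def homotopyEquiv : ContinuousMap.HomotopyEquiv (Punctured x₀) (Link lam x₀) where
  toFun := linkProj lam x₀
  invFun := hφ.linkSection
  left_inv := ContinuousMap.Homotopic.symm hφ.homotopicRel.homotopic
  right_inv := by
    rw [hφ.linkProj_comp_linkSection]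

end IsRadial

end Scaling

end

/-! ### The main theorem -/

theorem theorem3p9 {A : Type u} [CommRing A] [IsDomain A] [Algebra ℂ A] [Algebra.FiniteType ℂ A]
    {r n : ℕ} [MulAction (Torus r) (ComplexPoints A)]
    (hact : IsAlgebraicAction r A)
    (hdim : ringKrullDim A = (n : WithBot ℕ∞))
    (x₀ : ComplexPoints A) (hfix : ∀ t : Torus r, t • x₀ = x₀)
    (lam : ℂˣ →* Torus r) (hlam : IsOneParameterSubgroup lam)
    (hattr : IsAttractedBy lam x₀) :
    -- `X - {x₀}` is homeomorphic to `S(X) × ℝ^+`, and `S(X)` is compact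
    (Nonempty (Punctured x₀ ≃ₜ Link lam x₀ × Set.Ioi (0 : ℝ)) ∧ CompactSpace (Link lam x₀)) ∧
    -- `X - {x₀}` deformation retracts onto `S(X)`, embedded by a section of the quotient map
    (∃ s : C(Link lam x₀, Punctured x₀),
      (linkProj lam x₀).comp s = ContinuousMap.id (Link lam x₀) ∧
      (ContinuousMap.id (Punctured x₀)).HomotopicRel (s.comp (linkProj lam x₀)) (Set.range s)) ∧
    -- if `(X, x₀)` is a rational cell, then `X - {x₀}` and `S(X)` are rational cohomology spheres
    (RationallySmoothAt n (ComplexPoints A) x₀ →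
      IsRationalCohomologySphere (2 * (n : ℤ) - 1) (Punctured x₀) ∧
      IsRationalCohomologySphere (2 * (n : ℤ) - 1) (Link lam x₀)) ∧
    -- the criterion for rational smoothness at `x₀`
    ((∀ y : ComplexPoints A, y ≠ x₀ → RationallySmoothAt n (ComplexPoints A) y) →
      (RationallySmoothAt n (ComplexPoints A) x₀ ↔
        IsRationalCohomologySphere (2 * (n : ℤ) - 1) (Punctured x₀)) ∧
      (RationallySmoothAt n (ComplexPoints A) x₀ ↔
        IsRationalCohomologySphere (2 * (n : ℤ) - 1) (Link lam x₀))) := by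
  obtain ⟨φ, hφ⟩ := exists_isRadial hact hfix hlam hattr
  have := hφ.contractibleSpace
  have hlink := IsRationalCohomologySphere.iff_of_homotopyEquiv n hφ.homotopyEquiv
  have hsphere := rank_relH_iff_isRationalCohomologySphere n ({x₀}ᶜ : Set (ComplexPoints A))
  have hcell (h : RationallySmoothAt n (ComplexPoints A) x₀) :
      IsRationalCohomologySphere (2 * (n : ℤ) - 1) (Punctured x₀) := by
    obtain ⟨U, hU, h⟩ := h
    exact hsphere.1 (h x₀ (mem_of_mem_nhds hU))
  refine ⟨⟨⟨hφ.polarHomeomorph⟩, hφ.compactSpace_link⟩,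
    ⟨hφ.linkSection, hφ.linkProj_comp_linkSection, hφ.homotopicRel⟩,
    fun h => ⟨hcell h, hlink.1 (hcell h)⟩, fun hsmooth => ?_⟩
  have hiff : RationallySmoothAt n (ComplexPoints A) x₀ ↔
      IsRationalCohomologySphere (2 * (n : ℤ) - 1) (Punctured x₀) := by
    -- The whole space serves as neighbourhood: the sphere condition handles `x₀`, and smoothness
    -- elsewhere handles every other point.
    refine ⟨hcell, fun h => ⟨Set.univ, univ_mem, fun y _ => ?_⟩⟩
    by_cases hy : y = x₀
    · rw [hy]
      exact hsphere.2 h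
    · obtain ⟨U, hU, hyU⟩ := hsmooth y hy
      exact hyU y (mem_of_mem_nhds hU)
  exact ⟨hiff, hiff.trans hlink⟩
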